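/- Let $d\ge 1$ and let $\Omega\subset\mathbb{R}^d$ be a bounded domain (a nonempty, connected, bounded open set). A \emph{Dirichlet eigenfunction} of $\Omega$ with eigenvalue $\lambda\in\mathbb{R}$ is a nonzero real function $u\in H^1_0(\Omega)$ (the closure of $C_c^\infty(\Omega)$ in $H^1(\Omega)$) with $-\Delta u=\lambda u$ weakly, that is, $\int_\Omega\nabla u\cdot\nabla\psi\,dx=\lambda\int_\Omega u\,\psi\,dx$ for all $\psi\in C_c^\infty(\Omega)$. Then there is an $L^2(\Omega)$-orthonormal sequence $(\phi_k)_{k\in\mathbb{N}}$ of Dirichlet eigenfunctions, with eigenvalues $(\lambda_k)_{k\in\mathbb{N}}$, that lists all of them with multiplicity: every Dirichlet eigenfunction with eigenvalue $\lambda$ is a finite linear combination of those $\phi_k$ with $\lambda_k=\lambda$. Moreover, for every such sequence (in whatever order, and however the bases of the eigenspaces are chosen), infinitely many of the $\phi_k$ have nonzero mean value: the set $$\Big\{k\in\mathbb{N} : \frac{1}{|\Omega|}\int_\Omega \phi_k(x)\,dx\neq 0\Big\}$$ is infinite. -/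

import Mathlib

/-!
Dirichlet eigenfunctions are the eigenvectors, for the nonzero eigenvalues, of the resolvent
`(1 - Δ)⁻¹ = J ∘ J†`, where `J` is the inclusion of `H¹₀(Ω)` into `L²(Ω)`. Replacing a function by
its means over balls of radius `r` is a compact operator on `L²(Ω)`, it has small norm when `r` is
large compared with the volume of `Ω`, and it moves an element of `H¹₀(Ω)` by at most `r ‖∇u‖`.
Letting `r → 0` shows that `J` is compact, and taking `r` large gives the Poincaré inequality. Hence
the eigenfunctions span a dense subspace of `L²(Ω)`. If all but finitely many of them had mean
zero, the constant function `1` would be a finite linear combination of eigenfunctions and so lie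
in `H¹₀(Ω)`, against the Poincaré inequality.
-/

open MeasureTheory Filter Topology TopologicalSpace
open scoped Distributions Gradient

/-- `u` belongs to `H¹₀(Ω)` and `g` is its weak gradient: `(u, g)` is the limit in
`L²(Ω) × L²(Ω; ℝᵈ)` of pairs `(ψ, ∇ψ)` with `ψ` a smooth function compactly supported in `Ω`. -/
def HasDirichletGradient {d : ℕ} (Ω : Opens (EuclideanSpace ℝ (Fin d)))
    (u : Lp ℝ 2 (volume.restrict (Ω : Set (EuclideanSpace ℝ (Fin d)))))
    (g : Lp (EuclideanSpace ℝ (Fin d)) 2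
      (volume.restrict (Ω : Set (EuclideanSpace ℝ (Fin d))))) : Prop :=
  ∃ ψ : ℕ → 𝓓(Ω, ℝ),
    Tendsto (fun n => eLpNorm (fun x => ψ n x - u x) 2
      (volume.restrict (Ω : Set (EuclideanSpace ℝ (Fin d))))) atTop (𝓝 0) ∧
    Tendsto (fun n => eLpNorm (fun x => ∇ (ψ n) x - g x) 2
      (volume.restrict (Ω : Set (EuclideanSpace ℝ (Fin d))))) atTop (𝓝 0)

/-- `u` is a Dirichlet eigenfunction of the Laplacian on `Ω` with eigenvalue `ev`: a nonzero
element of `H¹₀(Ω)` with `-Δu = ev • u` weakly in `Ω`. -/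
def IsDirichletEigenfunction {d : ℕ} (Ω : Opens (EuclideanSpace ℝ (Fin d))) (ev : ℝ)
    (u : Lp ℝ 2 (volume.restrict (Ω : Set (EuclideanSpace ℝ (Fin d))))) : Prop :=
  u ≠ 0 ∧ ∃ g, HasDirichletGradient Ω u g ∧
    ∀ ψ : 𝓓(Ω, ℝ), ∫ x in Ω, inner ℝ (g x) (∇ ψ x) = ev * ∫ x in Ω, u x * ψ x

/-- `φ` is an `L²(Ω)`-orthonormal sequence of Dirichlet eigenfunctions with eigenvalues `ev` that
lists all Dirichlet eigenfunctions with multiplicity: every eigenfunction is a finite linear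
combination of those `φ k` that have the same eigenvalue. The order of the list is arbitrary. -/
structure IsDirichletEigensequence {d : ℕ} (Ω : Opens (EuclideanSpace ℝ (Fin d)))
    (ev : ℕ → ℝ)
    (φ : ℕ → Lp ℝ 2 (volume.restrict (Ω : Set (EuclideanSpace ℝ (Fin d))))) : Prop where
  orthonormal : Orthonormal ℝ φ
  eigenfunction : ∀ k, IsDirichletEigenfunction Ω (ev k) (φ k)
  exhaustive : ∀ μ u, IsDirichletEigenfunction Ω μ u →
    u ∈ Submodule.span ℝ (φ '' {k | ev k = μ})

section averaging

theorem eLpNorm_integral_le_of_ae_le {α T G : Type*} [MeasurableSpace α] [MeasurableSpace T]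
    [NormedAddCommGroup G] [NormedSpace ℝ G] {μ : Measure α} [SFinite μ] {P : Measure T}
    [IsProbabilityMeasure P] {p : ENNReal} (hp : 1 ≤ p) (hp_top : p ≠ ⊤) {F : α → T → G}
    (hF : AEStronglyMeasurable (Function.uncurry F) (μ.prod P)) {C : ENNReal}
    (hC : ∀ᵐ t ∂P, eLpNorm (fun x ↦ F x t) p μ ≤ C) :
    eLpNorm (fun x ↦ ∫ t, F x t ∂P) p μ ≤ C := by
  have hp0 : p ≠ 0 := (one_pos.trans_le hp).ne'
  have hpos : 0 < p.toReal := ENNReal.toReal_pos hp0 hp_top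
  have hle : ∀ {β : Type _} [MeasurableSpace β] {ν : Measure β} {f : β → G},
      eLpNorm f p ν ≤ C ↔ ∫⁻ x, ‖f x‖ₑ ^ p.toReal ∂ν ≤ C ^ p.toReal := fun {_ _ _ _} ↦ by
    rw [eLpNorm_eq_lintegral_rpow_enorm_toReal hp0 hp_top, one_div, ENNReal.rpow_inv_le_iff hpos]
  have jensen : ∀ᵐ x ∂μ, ‖∫ t, F x t ∂P‖ₑ ^ p.toReal ≤ ∫⁻ t, ‖F x t‖ₑ ^ p.toReal ∂P := by
    filter_upwards [hF.prodMk_left] with x hx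
    rw [← ENNReal.le_rpow_inv_iff hpos, ← one_div,
      ← eLpNorm_eq_lintegral_rpow_enorm_toReal hp0 hp_top (f := F x)]
    calc ‖∫ t, F x t ∂P‖ₑ ≤ ∫⁻ t, ‖F x t‖ₑ ∂P := enorm_integral_le_lintegral_enorm _
      _ = eLpNorm (F x) 1 P := eLpNorm_one_eq_lintegral_enorm.symm
      _ ≤ eLpNorm (F x) p P := eLpNorm_le_eLpNorm_of_exponent_le hp hx
  rw [hle]
  calc ∫⁻ x, ‖∫ t, F x t ∂P‖ₑ ^ p.toReal ∂μ
      ≤ ∫⁻ x, ∫⁻ t, ‖F x t‖ₑ ^ p.toReal ∂P ∂μ := lintegral_mono_ae jensen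
    _ = ∫⁻ t, ∫⁻ x, ‖F x t‖ₑ ^ p.toReal ∂μ ∂P :=
        lintegral_lintegral_swap (hF.enorm.pow_const _)
    _ ≤ ∫⁻ _, C ^ p.toReal ∂P := by
        refine lintegral_mono_ae ?_
        filter_upwards [hC] with t ht using hle.1 ht
    _ = C ^ p.toReal := by simp

open Metric in
theorem setAverage_ball_eq_setAverage_ball_zero {E F : Type*} [NormedAddCommGroup E]
    [MeasurableSpace E] [BorelSpace E] [NormedAddCommGroup F] [NormedSpace ℝ F] (μ : Measure E)
    [μ.IsAddHaarMeasure] (x : E) (r : ℝ) (f : E → F) :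
    ⨍ y in ball x r, f y ∂μ = ⨍ z in ball 0 r, f (x + z) ∂μ := by
  have hpre : (x + ·) ⁻¹' ball x r = ball 0 r := by
    ext z; simp
  have h := (measurePreserving_add_left μ x).restrict_preimage (s := ball x r) measurableSet_ball
  rw [hpre] at h
  rw [setAverage_eq, setAverage_eq, Measure.addHaar_real_ball_center,
    ← h.integral_comp (MeasurableEquiv.addLeft x).measurableEmbedding]

variable {E F : Type*} [NormedAddCommGroup E] [NormedSpace ℝ E] [NormedAddCommGroup F]
  [NormedSpace ℝ F] {ψ : E → F}

theorem sub_eq_setIntegral_fderiv_apply [CompleteSpace F] (hψ : ContDiff ℝ 1 ψ) (x z : E) :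
    ψ (x + z) - ψ x = ∫ t in Set.Ioc (0 : ℝ) 1, fderiv ℝ ψ (x + t • z) z := by
  have hline (t : ℝ) : HasDerivAt (fun t : ℝ ↦ ψ (x + t • z)) (fderiv ℝ ψ (x + t • z) z) t := by
    have h : HasDerivAt (fun t : ℝ ↦ x + t • z) z t := by
      simpa using ((hasDerivAt_id t).smul_const z).const_add x
    exact (hψ.differentiable one_ne_zero _).hasFDerivAt.comp_hasDerivAt t h
  have := hψ.continuous_fderiv one_ne_zero
  have hc : Continuous fun t : ℝ ↦ fderiv ℝ ψ (x + t • z) z := by fun_prop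
  have h := intervalIntegral.integral_eq_sub_of_hasDerivAt (a := 0) (b := 1)
    (fun t _ ↦ hline t) (hc.intervalIntegrable _ _)
  rw [← intervalIntegral.integral_of_le zero_le_one, h, one_smul, zero_smul, add_zero]

variable [FiniteDimensional ℝ E] [MeasurableSpace E] [BorelSpace E] {μ : Measure E} {p : ENNReal}

theorem eLpNorm_translate_sub_le [CompleteSpace F] [SFinite μ] [μ.IsAddRightInvariant]
    (hp : 1 ≤ p) (hp_top : p ≠ ⊤) (hψ : ContDiff ℝ 1 ψ) (z : E) :
    eLpNorm (fun x ↦ ψ (x + z) - ψ x) p μ ≤ ‖z‖ₑ * eLpNorm (fderiv ℝ ψ) p μ := by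
  have hcont := hψ.continuous_fderiv one_ne_zero
  have : IsProbabilityMeasure (volume.restrict (Set.Ioc (0 : ℝ) 1)) := ⟨by simp⟩
  simp only [sub_eq_setIntegral_fderiv_apply hψ]
  refine eLpNorm_integral_le_of_ae_le hp hp_top ?_ (Eventually.of_forall fun t ↦ ?_)
  · have : Continuous fun q : E × ℝ ↦ fderiv ℝ ψ (q.1 + q.2 • z) z := by fun_prop
    exact this.aestronglyMeasurable
  · calc eLpNorm (fun x ↦ fderiv ℝ ψ (x + t • z) z) p μ
        ≤ ‖z‖ₑ * eLpNorm (fun x ↦ fderiv ℝ ψ (x + t • z)) p μ := by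
          have hshift : Continuous fun x ↦ fderiv ℝ ψ (x + t • z) := by fun_prop
          refine eLpNorm_le_mul_eLpNorm_of_ae_le_mul'' p hshift.aestronglyMeasurable
            (.of_forall fun x ↦ ?_)
          rw [mul_comm]
          exact (fderiv ℝ ψ (x + t • z)).le_opENorm z
      _ = ‖z‖ₑ * eLpNorm (fderiv ℝ ψ) p μ := by
          congr 1
          exact eLpNorm_comp_measurePreserving hcont.aestronglyMeasurable
            (measurePreserving_add_right μ (t • z))

open Metric in
theorem eLpNorm_sub_setAverage_ball_le [CompleteSpace F] [μ.IsAddHaarMeasure]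
    (hp : 1 ≤ p) (hp_top : p ≠ ⊤) (hψ : ContDiff ℝ 1 ψ) {r : ℝ} (hr : 0 < r) :
    eLpNorm (fun x ↦ ψ x - ⨍ y in ball x r, ψ y ∂μ) p μ ≤
      ENNReal.ofReal r * eLpNorm (fderiv ℝ ψ) p μ := by
  have hball0 : μ (ball 0 r) ≠ 0 := (measure_ball_pos μ 0 hr).ne'
  have hballtop : μ (ball 0 r) ≠ ⊤ := measure_ball_lt_top.ne
  let P : Measure E := (μ.restrict (ball 0 r) Set.univ)⁻¹ • μ.restrict (ball 0 r)
  have : IsProbabilityMeasure P := by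
    refine ⟨?_⟩
    simp [P, ENNReal.inv_mul_cancel hball0 hballtop]
  have hP : ∀ᵐ z ∂P, z ∈ ball (0 : E) r :=
    Measure.smul_absolutelyContinuous.ae_le (ae_restrict_mem measurableSet_ball)
  have hint (x : E) : Integrable (fun z ↦ ψ (x + z)) P := by
    have hcont : Continuous fun z ↦ ψ (x + z) := by have := hψ.continuous; fun_prop
    refine IntegrableOn.integrable ?_ |>.smul_measure ?_
    · exact (hcont.continuousOn.integrableOn_compact (isCompact_closedBall 0 r)).mono_set
        ball_subset_closedBall
    · simpa using hball0
  have hav (x : E) : ψ x - ⨍ y in ball x r, ψ y ∂μ = ∫ z, (ψ x - ψ (x + z)) ∂P := by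
    rw [setAverage_ball_eq_setAverage_ball_zero, average_eq',
      integral_sub (integrable_const _) (hint x), integral_const, probReal_univ, one_smul]
  simp only [hav]
  refine eLpNorm_integral_le_of_ae_le hp hp_top ?_ ?_
  · have hcont := hψ.continuous
    have : Continuous fun q : E × E ↦ ψ q.1 - ψ (q.1 + q.2) := by fun_prop
    exact this.aestronglyMeasurable
  · filter_upwards [hP] with z hz
    calc eLpNorm (fun x ↦ ψ x - ψ (x + z)) p μ = eLpNorm (fun x ↦ ψ (x + z) - ψ x) p μ := by
          exact eLpNorm_sub_comm _ _ _ _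
      _ ≤ ‖z‖ₑ * eLpNorm (fderiv ℝ ψ) p μ := eLpNorm_translate_sub_le hp hp_top hψ z
      _ ≤ ENNReal.ofReal r * eLpNorm (fderiv ℝ ψ) p μ := by
          gcongr
          rw [← ofReal_norm]
          exact ENNReal.ofReal_le_ofReal (mem_ball_zero_iff.1 hz).le

end averaging

section kernelOperator

variable {𝕜 V F α : Type*} [NontriviallyNormedField 𝕜] [NormedAddCommGroup V] [NormedSpace 𝕜 V]
  [NormedAddCommGroup F] [NormedSpace 𝕜 F] [MeasurableSpace α] {μ : Measure α} {p : ENNReal}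
  [Fact (1 ≤ p)]

/-- The operator `v ↦ (x ↦ k x v)` from `V` to `Lᵖ(μ)` with the operator-valued kernel `k`, as a
continuous linear function of `k`. -/
noncomputable def kernelOperator :
    Lp (V →L[𝕜] F) p μ →L[𝕜] V →L[𝕜] Lp F p μ :=
  ((ContinuousLinearMap.apply 𝕜 F).compLpL₂ p μ).flip

theorem coeFn_kernelOperator (k : Lp (V →L[𝕜] F) p μ) (v : V) :
    kernelOperator k v =ᵐ[μ] fun x ↦ k x v :=
  (ContinuousLinearMap.apply 𝕜 F v).coeFn_compLp k

theorem norm_kernelOperator_le (k : Lp (V →L[𝕜] F) p μ) : ‖kernelOperator k‖ ≤ ‖k‖ := by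
  refine ContinuousLinearMap.opNorm_le_bound _ (norm_nonneg k) fun v ↦ ?_
  rw [mul_comm]
  refine Lp.norm_le_mul_norm_of_ae_le_mul ?_
  filter_upwards [coeFn_kernelOperator k v] with x hx
  rw [hx, mul_comm]
  exact (k x).le_opNorm v

theorem kernelOperator_indicatorConstLp {s : Set α} (hs : MeasurableSet s) (hμs : μ s ≠ ⊤)
    (T : V →L[𝕜] F) :
    kernelOperator (indicatorConstLp p hs hμs T) =
      ((ContinuousLinearMap.lsmul 𝕜 𝕜).flip.compLpL₂ p μ).flip
        (indicatorConstLp p hs hμs (1 : 𝕜)) ∘L T := by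
  ext v : 2
  filter_upwards [coeFn_kernelOperator (indicatorConstLp p hs hμs T) v,
    ((ContinuousLinearMap.lsmul 𝕜 𝕜).flip (T v)).coeFn_compLp (indicatorConstLp p hs hμs (1 : 𝕜)),
    indicatorConstLp_coeFn (p := p) (hs := hs) (hμs := hμs) (c := T),
    indicatorConstLp_coeFn (p := p) (hs := hs) (hμs := hμs) (c := (1 : 𝕜))] with x h₁ h₂ h₃ h₄
  rw [h₁, h₃]
  refine Eq.trans ?_ h₂.symm
  rw [h₄]
  by_cases hx : x ∈ s <;> simp [hx]

theorem isCompactOperator_kernelOperator [LocallyCompactSpace F] (hp : p ≠ ⊤)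
    (k : Lp (V →L[𝕜] F) p μ) : IsCompactOperator (kernelOperator k) := by
  have : CompleteSpace F := IsRightUniformAddGroup.completeSpace_of_weaklyLocallyCompactSpace
  induction k using Lp.induction hp with
  | indicatorConst T hs hμs =>
    rw [Lp.simpleFunc.coe_indicatorConst, kernelOperator_indicatorConstLp,
      ContinuousLinearMap.coe_comp]
    exact (isCompactOperator_of_locallyCompactSpace_rng _).comp_clm T
  | add hf hg _ hf_compact hg_compact =>
    rw [map_add]
    exact hf_compact.add hg_compact
  | isClosed =>
    exact isClosed_setOfPred_isCompactOperator.preimage kernelOperator.continuous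

end kernelOperator

section ballMean

open Metric

theorem tendsto_measure_symmDiff_ball {E : Type*} [NormedAddCommGroup E] [ProperSpace E]
    [MeasurableSpace E] [BorelSpace E] {μ : Measure E} [μ.IsAddHaarMeasure] (x : E) (r : ℝ) :
    Tendsto (fun y ↦ μ (symmDiff (ball y r) (ball x r))) (𝓝 x) (𝓝 0) := by
  let shift : E → C(E, E) := fun y ↦ ⟨fun z ↦ z - y, by fun_prop⟩
  have hshift : Continuous shift :=
    ContinuousMap.continuous_of_continuous_uncurry _ (by
      change Continuous fun q : E × E ↦ q.2 - q.1
      fun_prop)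
  have hpre (y : E) : shift y ⁻¹' ball 0 r = ball y r := by
    ext z; simp [shift, dist_eq_norm]
  have hpres (y : E) : MeasurePreserving (shift y) μ μ := measurePreserving_sub_right μ y
  have h := tendsto_measure_symmDiff_preimage_nhds_zero (hshift.tendsto x) (.of_forall hpres)
    (hpres x) (measurableSet_ball (x := 0) (ε := r)).nullMeasurableSet measure_ball_lt_top.ne
  simpa only [hpre] using h

theorem tendsto_measureReal_ball_atTop {E : Type*} [NormedAddCommGroup E] [NormedSpace ℝ E]
    [FiniteDimensional ℝ E] [Nontrivial E] [MeasurableSpace E] [BorelSpace E] (μ : Measure E)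
    [μ.IsAddHaarMeasure] (x : E) :
    Tendsto (fun r ↦ μ.real (ball x r)) atTop atTop := by
  have hball : 0 < μ.real (ball (0 : E) 1) :=
    ENNReal.toReal_pos (measure_ball_pos μ 0 one_pos).ne' measure_ball_lt_top.ne
  refine ((tendsto_pow_atTop (Module.finrank_pos (R := ℝ) (M := E)).ne').atTop_mul_const
    hball).congr' ?_
  filter_upwards [eventually_ge_atTop 0] with r hr
  rw [← Measure.addHaar_real_closedBall_eq_addHaar_real_ball μ x r,
    Measure.addHaar_real_closedBall μ x hr]

variable {E : Type*} [NormedAddCommGroup E] [NormedSpace ℝ E] [FiniteDimensional ℝ E]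
  [MeasurableSpace E] [BorelSpace E] {μ : Measure E} [μ.IsAddHaarMeasure] {s : Set E}

variable (μ s) in
/-- The functional on `L²(s)` that integrates over `ball x r ∩ s` and divides by the volume of
the whole ball: the mean over the ball of the extension by zero. -/
noncomputable def ballMean (r : ℝ) (x : E) : Lp ℝ 2 (μ.restrict s) →L[ℝ] ℝ :=
  (μ.real (ball 0 r))⁻¹ • innerSL ℝ
    (indicatorConstLp 2 (measurableSet_ball (x := x) (ε := r)) measure_ball_lt_top.ne 1)

theorem ballMean_apply (r : ℝ) (x : E) (u : Lp ℝ 2 (μ.restrict s)) :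
    ballMean μ s r x u = (μ.real (ball 0 r))⁻¹ * ∫ y in ball x r, u y ∂μ.restrict s := by
  rw [ballMean, smul_apply, innerSL_apply_apply, L2.inner_indicatorConstLp_one, smul_eq_mul]

theorem ballMean_toLp (r : ℝ) (x : E) {f : E → ℝ} (hf : MemLp f 2 (μ.restrict s))
    (hfs : ∀ x ∉ s, f x = 0) :
    ballMean μ s r x (hf.toLp f) = ⨍ y in ball x r, f y ∂μ := by
  rw [ballMean_apply, setAverage_eq, Measure.addHaar_real_ball_center μ x, smul_eq_mul,
    integral_congr_ae (ae_restrict_of_ae hf.coeFn_toLp),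
    Measure.restrict_restrict measurableSet_ball]
  congr 1
  refine (setIntegral_eq_of_subset_of_forall_sdiff_eq_zero measurableSet_ball
    Set.inter_subset_left fun y hy ↦ hfs y fun hys ↦ hy.2 ⟨hy.1, hys⟩).symm

theorem continuous_ballMean (r : ℝ) : Continuous (ballMean μ s r) := by
  have hind : Continuous fun x ↦ indicatorConstLp 2 (μ := μ.restrict s)
      (measurableSet_ball (x := x) (ε := r)) measure_ball_lt_top.ne (1 : ℝ) :=
    continuous_indicatorConstLp_set ENNReal.ofNat_ne_top fun x ↦
      tendsto_of_tendsto_of_tendsto_of_le_of_le tendsto_const_nhds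
        (tendsto_measure_symmDiff_ball x r) (fun _ ↦ zero_le) fun _ ↦ Measure.restrict_apply_le _ _
  exact ((innerSL ℝ).continuous.comp hind).const_smul (μ.real (ball 0 r))⁻¹

theorem norm_ballMean_le (r : ℝ) (x : E) :
    ‖ballMean μ s r x‖ ≤ (√(μ.real (ball 0 r)))⁻¹ := by
  have hind : ‖indicatorConstLp 2 (μ := μ.restrict s) (measurableSet_ball (x := x) (ε := r))
      measure_ball_lt_top.ne (1 : ℝ)‖ ≤ √(μ.real (ball 0 r)) := by
    rw [norm_indicatorConstLp two_ne_zero ENNReal.ofNat_ne_top, norm_one, one_mul,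
      Real.sqrt_eq_rpow, ← Measure.addHaar_real_ball_center μ x]
    norm_num only [ENNReal.toReal_ofNat]
    gcongr
    exact ENNReal.toReal_mono measure_ball_lt_top.ne (Measure.restrict_apply_le _ _)
  calc ‖ballMean μ s r x‖
      ≤ (μ.real (ball 0 r))⁻¹ * √(μ.real (ball 0 r)) := by
        rw [ballMean, norm_smul, innerSL_apply_norm, Real.norm_of_nonneg (by positivity)]
        gcongr
    _ = (√(μ.real (ball 0 r)))⁻¹ := by
        rw [← div_eq_inv_mul, Real.sqrt_div_self]

theorem memLp_ballMean (hs : μ s ≠ ⊤) (r : ℝ) : MemLp (ballMean μ s r) 2 (μ.restrict s) := by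
  have := isFiniteMeasure_restrict.2 hs
  exact .of_bound (continuous_ballMean r).aestronglyMeasurable _
    (.of_forall (norm_ballMean_le r))

/-- The operator on `L²(s)` that replaces a function by its means over the balls of radius `r`,
extending it by zero outside `s`. -/
noncomputable def ballMeanOperator (hs : μ s ≠ ⊤) (r : ℝ) :
    Lp ℝ 2 (μ.restrict s) →L[ℝ] Lp ℝ 2 (μ.restrict s) :=
  kernelOperator ((memLp_ballMean hs r).toLp _)

theorem coeFn_ballMeanOperator (hs : μ s ≠ ⊤) (r : ℝ) (u : Lp ℝ 2 (μ.restrict s)) :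
    ballMeanOperator hs r u =ᵐ[μ.restrict s] fun x ↦ ballMean μ s r x u := by
  filter_upwards [coeFn_kernelOperator ((memLp_ballMean hs r).toLp _) u,
    (memLp_ballMean hs r).coeFn_toLp] with x hx hx'
  rw [← hx']
  exact hx

theorem isCompactOperator_ballMeanOperator (hs : μ s ≠ ⊤) (r : ℝ) :
    IsCompactOperator (ballMeanOperator hs r) :=
  isCompactOperator_kernelOperator ENNReal.ofNat_ne_top _

theorem norm_ballMeanOperator_le (hs : μ s ≠ ⊤) (r : ℝ) :
    ‖ballMeanOperator hs r‖ ≤ √(μ.real s / μ.real (ball 0 r)) := by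
  have := isFiniteMeasure_restrict.2 hs
  refine (norm_kernelOperator_le _).trans ?_
  refine (Lp.norm_le_of_ae_bound (C := (√(μ.real (ball 0 r)))⁻¹) (by positivity) ?_).trans_eq ?_
  · filter_upwards [(memLp_ballMean hs r).coeFn_toLp] with x hx
    rw [hx]
    exact norm_ballMean_le r x
  · rw [Real.sqrt_div measureReal_nonneg, div_eq_mul_inv, Real.sqrt_eq_rpow (μ.real s)]
    simp [measureUnivNNReal, measureReal_def, ENNReal.coe_toNNReal_eq_toReal]

theorem enorm_toLp_sub_ballMeanOperator_le (hs : μ s ≠ ⊤) {r : ℝ} (hr : 0 < r) {ψ : E → ℝ}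
    (hψ : ContDiff ℝ 1 ψ) (hψs : tsupport ψ ⊆ s) (hψ2 : MemLp ψ 2 (μ.restrict s)) :
    ‖hψ2.toLp ψ - ballMeanOperator hs r (hψ2.toLp ψ)‖ₑ ≤
      ENNReal.ofReal r * eLpNorm (fderiv ℝ ψ) 2 (μ.restrict s) := by
  have hae : ⇑(hψ2.toLp ψ - ballMeanOperator hs r (hψ2.toLp ψ)) =ᵐ[μ.restrict s]
      fun x ↦ ψ x - ⨍ y in ball x r, ψ y ∂μ := by
    filter_upwards [Lp.coeFn_sub (hψ2.toLp ψ) (ballMeanOperator hs r (hψ2.toLp ψ)),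
      hψ2.coeFn_toLp, coeFn_ballMeanOperator hs r (hψ2.toLp ψ)] with x hsub hx hmean
    rw [hsub, Pi.sub_apply, hx, hmean, ballMean_toLp r x hψ2 fun y hy ↦
      image_eq_zero_of_notMem_tsupport fun h ↦ hy (hψs h)]
  rw [Lp.enorm_def, eLpNorm_congr_ae hae,
    eLpNorm_restrict_eq_of_support_subset (f := fderiv ℝ ψ)
      ((support_fderiv_subset ℝ).trans hψs)]
  exact (eLpNorm_mono_measure _ Measure.restrict_le_self).trans
    (eLpNorm_sub_setAverage_ball_le one_le_two ENNReal.ofNat_ne_top hψ hr)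

end ballMean

section hilbert

variable {𝕜 H : Type*} [RCLike 𝕜] [NormedAddCommGroup H] [InnerProductSpace 𝕜 H]

theorem countable_of_orthonormal [SeparableSpace H] {ι : Type*} {e : ι → H}
    (he : Orthonormal 𝕜 e) : Countable ι := by
  have hdisj : Pairwise fun i j ↦
      Disjoint (Metric.ball (e i) (1 / 2)) (Metric.ball (e j) (1 / 2)) := by
    intro i j hij
    refine Metric.ball_disjoint_ball ?_
    have h : ‖e i - e j‖ ^ 2 = 2 := by
      rw [norm_sub_sq (𝕜 := 𝕜), he.1 i, he.1 j, he.2 hij]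
      norm_num
    rw [dist_eq_norm]
    nlinarith [norm_nonneg (e i - e j)]
  exact hdisj.countable_of_isOpen_disjoint (fun _ ↦ Metric.isOpen_ball)
    fun i ↦ ⟨e i, Metric.mem_ball_self (by norm_num)⟩

theorem infinite_setOf_inner_ne_zero [CompleteSpace H] {ι : Type*} {e : ι → H}
    (he : Orthonormal 𝕜 e) (hcomplete : (Submodule.span 𝕜 (Set.range e))ᗮ = ⊥)
    {D : Submodule 𝕜 H} (heD : ∀ i, e i ∈ D) {f : H} (hf : f ∉ D) :
    {i | inner 𝕜 (e i) f ≠ 0}.Infinite := by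
  intro hfin
  let b := HilbertBasis.mkOfOrthogonalEqBot he hcomplete
  have hrepr (i : ι) : b.repr f i = inner 𝕜 (e i) f := by
    rw [b.repr_apply_apply, HilbertBasis.coe_mkOfOrthogonalEqBot]
  have hsum : f = ∑ i ∈ hfin.toFinset, b.repr f i • b i :=
    (b.hasSum_repr f).unique <| hasSum_sum_of_ne_finset_zero fun i hi ↦ by
      have : inner 𝕜 (e i) f = 0 := by simpa using hi
      rw [hrepr, this, zero_smul]
  refine hf (hsum ▸ D.sum_mem fun i _ ↦ D.smul_mem _ ?_)
  rw [HilbertBasis.coe_mkOfOrthogonalEqBot]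
  exact heD i

theorem exists_orthonormal_span_image_eq {κ : Type*} {W : κ → Submodule 𝕜 H}
    [∀ k, FiniteDimensional 𝕜 (W k)]
    (hW : OrthogonalFamily 𝕜 (fun k ↦ W k) fun k ↦ (W k).subtypeₗᵢ) :
    ∃ (ι : κ → Type) (e : (Σ k, ι k) → H), Orthonormal 𝕜 e ∧
      ∀ k, Submodule.span 𝕜 (e '' {i | i.1 = k}) = W k := by
  let b k := stdOrthonormalBasis 𝕜 (W k)
  refine ⟨fun k ↦ Fin (Module.finrank 𝕜 (W k)), fun i ↦ b i.1 i.2,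
    hW.orthonormal_sigma_orthonormal fun k ↦ (b k).orthonormal, fun k ↦ ?_⟩
  have himage : (fun i : Σ k, Fin (Module.finrank 𝕜 (W k)) ↦ (b i.1 i.2 : H)) '' {i | i.1 = k} =
      (W k).subtype '' Set.range (b k) := by
    ext u
    constructor
    · rintro ⟨⟨_, i⟩, rfl, rfl⟩
      exact ⟨_, ⟨i, rfl⟩, rfl⟩
    · rintro ⟨_, ⟨i, rfl⟩, rfl⟩
      exact ⟨⟨k, i⟩, rfl, rfl⟩
  rw [himage, Submodule.span_image, ← (b k).coe_toBasis, (b k).toBasis.span_eq,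
    Submodule.map_top, Submodule.range_subtype]

theorem exists_orthonormal_span_image_eq_eigenspace [CompleteSpace H] {T : H →L[𝕜] H}
    (hT : IsCompactOperator T) (hsymm : T.IsSymmetric) :
    ∃ (ι : {μ : 𝕜 // μ ≠ 0} → Type) (e : (Σ μ, ι μ) → H), Orthonormal 𝕜 e ∧
      ∀ μ, Submodule.span 𝕜 (e '' {i | i.1 = μ}) =
        Module.End.eigenspace (T : Module.End 𝕜 H) μ.1 := by
  have (μ : {μ : 𝕜 // μ ≠ 0}) :
      FiniteDimensional 𝕜 (Module.End.eigenspace (T : Module.End 𝕜 H) μ.1) :=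
    ContinuousLinearMap.finite_dimensional_eigenspace hT μ.1 μ.2
  exact exists_orthonormal_span_image_eq
    (hsymm.orthogonalFamily_eigenspaces.comp Subtype.coe_injective)

theorem orthogonal_eq_bot_of_eigenspace_le [CompleteSpace H] {T : H →L[𝕜] H}
    (hT : IsCompactOperator T) (hsymm : T.IsSymmetric) (hinj : Function.Injective T)
    {K : Submodule 𝕜 H} (hK : ∀ μ ≠ 0, Module.End.eigenspace (T : Module.End 𝕜 H) μ ≤ K) :
    Kᗮ = ⊥ := by
  rw [eq_bot_iff, ← ContinuousLinearMap.orthogonalComplement_iSup_eigenspaces_eq_bot hT hsymm]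
  refine Submodule.orthogonal_le (iSup_le fun μ ↦ ?_)
  rcases eq_or_ne μ 0 with rfl | hμ
  · rw [Module.End.eigenspace_zero, LinearMap.ker_eq_bot.2 hinj]
    exact bot_le
  · exact hK μ hμ

open ContinuousLinearMap in
theorem comp_adjoint_apply_eq_iff {V : Type*} [NormedAddCommGroup V] [InnerProductSpace 𝕜 V]
    [CompleteSpace V] [CompleteSpace H] {J : V →L[𝕜] H} {α : Type*} {j : α → V}
    (hj : DenseRange j) {f u : H} :
    (J ∘L adjoint J) f = u ↔ ∃ w, J w = u ∧ ∀ a, inner 𝕜 w (j a) = inner 𝕜 f (J (j a)) := by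
  refine ⟨fun h ↦ ⟨adjoint J f, h, fun a ↦ adjoint_inner_left J (j a) f⟩, ?_⟩
  rintro ⟨w, rfl, h⟩
  have hw : adjoint J f = w := Dense.eq_of_inner_left 𝕜 hj <| Set.forall_mem_range.2 fun a ↦ by
    rw [adjoint_inner_left, h a]
  rw [comp_apply, hw]

end hilbert

section testFunction

variable {E F : Type*} [NormedAddCommGroup E] [InnerProductSpace ℝ E]
  [NormedAddCommGroup F] [NormedSpace ℝ F] {Ω : Opens E}

variable (Ω) in
/-- The gradient of a test function, as a vector-valued test function. -/
noncomputable def gradientTestFunction [CompleteSpace E] : 𝓓(Ω, ℝ) →L[ℝ] 𝓓(Ω, E) :=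
  let riesz : (E →L[ℝ] ℝ) →L[ℝ] E :=
    { toFun := (InnerProductSpace.toDual ℝ E).symm
      map_add' := map_add _
      map_smul' c := map_smulₛₗ _ c
      cont := LinearIsometryEquiv.continuous _ }
  TestFunction.postcompCLM riesz ∘L TestFunction.fderivCLM ℝ ⊤ ⊤

theorem coe_gradientTestFunction [CompleteSpace E] (ψ : 𝓓(Ω, ℝ)) :
    ⇑(gradientTestFunction Ω ψ) = ∇ ψ := by
  ext1 x
  simp [gradientTestFunction, gradient]

variable [MeasurableSpace E] [BorelSpace E] {μ : Measure E}

theorem memLp_testFunction [IsFiniteMeasureOnCompacts μ] (p : ENNReal) (ψ : 𝓓(Ω, F)) :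
    MemLp ψ p μ :=
  ψ.continuous.memLp_of_hasCompactSupport ψ.hasCompactSupport

variable [FiniteDimensional ℝ E]

theorem setIntegral_mul_fderiv_testFunction_eq_neg [μ.IsAddHaarMeasure] {f : E → ℝ}
    (hf : ContDiff ℝ 1 f) (ψ : 𝓓(Ω, ℝ)) (v : E) :
    ∫ x in Ω, f x * fderiv ℝ ψ x v ∂μ = -∫ x in Ω, fderiv ℝ f x v * ψ x ∂μ := by
  have hψ : ContDiff ℝ 1 ψ := ψ.contDiff.of_le (by exact_mod_cast le_top)
  have hψ0 : ∀ x ∉ Ω, ψ x = 0 ∧ fderiv ℝ ψ x = 0 := fun x hx ↦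
    have hx' := fun h ↦ hx (ψ.tsupport_subset h)
    ⟨image_eq_zero_of_notMem_tsupport hx', fderiv_of_notMem_tsupport ℝ hx'⟩
  have hf' := hf.continuous_fderiv one_ne_zero
  have hψ' := hψ.continuous_fderiv one_ne_zero
  have hψ'c : HasCompactSupport fun x ↦ fderiv ℝ ψ x v := ψ.hasCompactSupport.fderiv_apply ℝ v
  rw [setIntegral_eq_integral_of_forall_compl_eq_zero fun x hx ↦ by simp [hψ0 x hx],
    setIntegral_eq_integral_of_forall_compl_eq_zero fun x hx ↦ by simp [hψ0 x hx]]
  exact integral_mul_fderiv_eq_neg_fderiv_mul_of_integrable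
    ((hf'.clm_apply continuous_const).mul hψ.continuous |>.integrable_of_hasCompactSupport
      ψ.hasCompactSupport.mul_left)
    ((hf.continuous.mul (hψ'.clm_apply continuous_const)).integrable_of_hasCompactSupport
      hψ'c.mul_left)
    ((hf.continuous.mul ψ.continuous).integrable_of_hasCompactSupport
      ψ.hasCompactSupport.mul_left)
    (fun x _ ↦ hf.differentiable one_ne_zero x) (fun x _ ↦ hψ.differentiable one_ne_zero x)

theorem ae_eq_zero_of_forall_setIntegral_testFunction_smul_eq_zero [CompleteSpace F] {f : E → F}
    (hf : LocallyIntegrable f (μ.restrict Ω))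
    (h : ∀ ψ : 𝓓(Ω, ℝ), ∫ x in Ω, ψ x • f x ∂μ = 0) : f =ᵐ[μ.restrict Ω] 0 := by
  refine (ae_restrict_iff' Ω.isOpen.measurableSet).2 ?_
  refine Ω.isOpen.ae_eq_zero_of_integral_contDiff_smul_eq_zero
    (locallyIntegrableOn_of_locallyIntegrable_restrict hf) fun g hg hgc hgΩ ↦ ?_
  rw [← h ⟨g, hg, hgc, hgΩ⟩]
  refine (setIntegral_eq_integral_of_forall_compl_eq_zero fun x hx ↦ ?_).symm
  rw [image_eq_zero_of_notMem_tsupport fun hx' ↦ hx (hgΩ hx'), zero_smul]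

end testFunction

section dirichletSpace

variable {E : Type*} [NormedAddCommGroup E] [InnerProductSpace ℝ E] [FiniteDimensional ℝ E]
  [MeasurableSpace E] [BorelSpace E] (Ω : Opens E)

/-- The space `L²(Ω; F)`. -/
abbrev L2On (F : Type*) [NormedAddCommGroup F] : Type _ :=
  Lp F 2 (volume.restrict (Ω : Set E))

variable {Ω} in
/-- The class of a test function in `L²(Ω; F)`. -/
noncomputable def testFunctionToL2 {F : Type*} [NormedAddCommGroup F] [NormedSpace ℝ F] :
    𝓓(Ω, F) →ₗ[ℝ] L2On Ω F where
  toFun ψ := (memLp_testFunction 2 ψ).toLp ψ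
  map_add' _ _ := rfl
  map_smul' _ _ := rfl

/-- The map `ψ ↦ (ψ, ∇ψ)` on test functions. -/
noncomputable def testGraph : 𝓓(Ω, ℝ) →ₗ[ℝ] WithLp 2 (L2On Ω ℝ × L2On Ω E) :=
  (WithLp.linearEquiv 2 ℝ (L2On Ω ℝ × L2On Ω E)).symm.toLinearMap ∘ₗ
    testFunctionToL2.prod (testFunctionToL2 ∘ₗ (gradientTestFunction Ω).toLinearMap)

/-- The space `H¹₀(Ω)`, encoded as the closed subspace of `L²(Ω) × L²(Ω; E)` consisting of the
pairs of a function and its weak gradient. Its inner product is the one of `H¹(Ω)`. -/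
noncomputable def dirichletSpace : Submodule ℝ (WithLp 2 (L2On Ω ℝ × L2On Ω E)) :=
  (LinearMap.range (testGraph Ω)).topologicalClosure

instance : CompleteSpace (dirichletSpace Ω) :=
  inferInstanceAs (CompleteSpace (LinearMap.range (testGraph Ω)).topologicalClosure)

/-- The inclusion of `H¹₀(Ω)` into `L²(Ω)`. -/
noncomputable def dirichletInclusion : dirichletSpace Ω →L[ℝ] L2On Ω ℝ :=
  WithLp.fstL 2 ℝ _ _ ∘L (dirichletSpace Ω).subtypeL

/-- The weak gradient on `H¹₀(Ω)`. -/
noncomputable def dirichletGradient : dirichletSpace Ω →L[ℝ] L2On Ω E :=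
  WithLp.sndL 2 ℝ _ _ ∘L (dirichletSpace Ω).subtypeL

variable {Ω}

/-- A test function as an element of `H¹₀(Ω)`. -/
noncomputable def testFunctionToDirichletSpace (ψ : 𝓓(Ω, ℝ)) : dirichletSpace Ω :=
  ⟨testGraph Ω ψ, Submodule.le_topologicalClosure _ ⟨ψ, rfl⟩⟩

theorem denseRange_testFunctionToDirichletSpace :
    DenseRange (testFunctionToDirichletSpace : 𝓓(Ω, ℝ) → dirichletSpace Ω) := by
  refine Subtype.dense_iff.2 fun w hw ↦ ?_
  rwa [← Set.range_comp]

theorem dirichletInclusion_testFunction (ψ : 𝓓(Ω, ℝ)) :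
    dirichletInclusion Ω (testFunctionToDirichletSpace ψ) = testFunctionToL2 ψ :=
  rfl

theorem dirichletGradient_testFunction (ψ : 𝓓(Ω, ℝ)) :
    dirichletGradient Ω (testFunctionToDirichletSpace ψ) =
      testFunctionToL2 (gradientTestFunction Ω ψ) :=
  rfl

theorem inner_dirichletSpace (v w : dirichletSpace Ω) :
    inner ℝ v w = inner ℝ (dirichletInclusion Ω v) (dirichletInclusion Ω w) +
      inner ℝ (dirichletGradient Ω v) (dirichletGradient Ω w) :=
  rfl

theorem norm_dirichletGradient_le (w : dirichletSpace Ω) : ‖dirichletGradient Ω w‖ ≤ ‖w‖ :=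
  WithLp.norm_snd_le _ w.1

theorem tendsto_testFunctionToL2_iff {F : Type*} [NormedAddCommGroup F] [NormedSpace ℝ F]
    {ψ : ℕ → 𝓓(Ω, F)} {u : L2On Ω F} :
    Tendsto (fun n ↦ testFunctionToL2 (ψ n)) atTop (𝓝 u) ↔
      Tendsto (fun n ↦ eLpNorm (⇑(ψ n) - ⇑u) 2 (volume.restrict (Ω : Set E))) atTop (𝓝 0) := by
  rw [← Lp.tendsto_Lp_iff_tendsto_eLpNorm'' _ (fun n ↦ memLp_testFunction 2 (ψ n)) _ (Lp.memLp u),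
    Lp.toLp_coeFn]
  rfl

theorem mem_dirichletSpace_iff {u : L2On Ω ℝ} {g : L2On Ω E} :
    WithLp.toLp 2 (u, g) ∈ dirichletSpace Ω ↔ ∃ ψ : ℕ → 𝓓(Ω, ℝ),
      Tendsto (fun n ↦ testFunctionToL2 (ψ n)) atTop (𝓝 u) ∧
      Tendsto (fun n ↦ testFunctionToL2 (gradientTestFunction Ω (ψ n))) atTop (𝓝 g) := by
  have htendsto (ψ : ℕ → 𝓓(Ω, ℝ)) :
      Tendsto (fun n ↦ testGraph Ω (ψ n)) atTop (𝓝 (WithLp.toLp 2 (u, g))) ↔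
        Tendsto (fun n ↦ testFunctionToL2 (ψ n)) atTop (𝓝 u) ∧
        Tendsto (fun n ↦ testFunctionToL2 (gradientTestFunction Ω (ψ n))) atTop (𝓝 g) := by
    rw [(WithLp.homeomorphProd 2 (L2On Ω ℝ) (L2On Ω E)).isInducing.tendsto_nhds_iff]
    exact Prod.tendsto_iff _ _
  simp only [← htendsto]
  rw [dirichletSpace, ← SetLike.mem_coe, Submodule.topologicalClosure_coe,
    mem_closure_iff_seq_limit]
  refine ⟨fun ⟨v, hv, hlim⟩ ↦ ?_, fun ⟨ψ, hψ⟩ ↦ ?_⟩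
  · choose ψ hψ using hv
    exact ⟨ψ, by simpa only [hψ] using hlim⟩
  · exact ⟨_, fun n ↦ ⟨ψ n, rfl⟩, hψ⟩

theorem hasDirichletGradient_iff {d : ℕ} {Ω : Opens (EuclideanSpace ℝ (Fin d))} {u : L2On Ω ℝ}
    {g : L2On Ω (EuclideanSpace ℝ (Fin d))} :
    HasDirichletGradient Ω u g ↔
      ∃ w, dirichletInclusion Ω w = u ∧ dirichletGradient Ω w = g := by
  suffices HasDirichletGradient Ω u g ↔ WithLp.toLp 2 (u, g) ∈ dirichletSpace Ω by
    rw [this]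
    exact ⟨fun h ↦ ⟨⟨_, h⟩, rfl, rfl⟩, by rintro ⟨w, rfl, rfl⟩; exact w.2⟩
  simp only [mem_dirichletSpace_iff, tendsto_testFunctionToL2_iff, coe_gradientTestFunction]
  rfl

theorem inner_toLp_eq_integral {α F : Type*} [NormedAddCommGroup F] [InnerProductSpace ℝ F]
    [MeasurableSpace α] {μ : Measure α} (u : Lp F 2 μ) {f : α → F} (hf : MemLp f 2 μ) :
    inner ℝ u (hf.toLp f) = ∫ x, inner ℝ (u x) (f x) ∂μ := by
  rw [L2.inner_def]
  refine integral_congr_ae ?_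
  filter_upwards [hf.coeFn_toLp] with x hx
  rw [hx]

theorem inner_testFunctionToL2 {F : Type*} [NormedAddCommGroup F] [InnerProductSpace ℝ F]
    (u : L2On Ω F) (ψ : 𝓓(Ω, F)) :
    inner ℝ u (testFunctionToL2 ψ) = ∫ x in Ω, inner ℝ (u x) (ψ x) :=
  inner_toLp_eq_integral u (memLp_testFunction 2 ψ)

theorem eq_zero_of_forall_inner_testFunctionToL2_eq_zero {u : L2On Ω ℝ}
    (hu : ∀ ψ : 𝓓(Ω, ℝ), inner ℝ u (testFunctionToL2 ψ) = 0) : u = 0 := by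
  rw [Lp.eq_zero_iff_ae_eq_zero]
  refine ae_eq_zero_of_forall_setIntegral_testFunction_smul_eq_zero
    ((Lp.memLp u).locallyIntegrable one_le_two) fun ψ ↦ ?_
  rw [← hu ψ, inner_testFunctionToL2]
  rfl

end dirichletSpace

section rellich

open Metric

variable {E : Type*} [NormedAddCommGroup E] [InnerProductSpace ℝ E] [FiniteDimensional ℝ E]
  [MeasurableSpace E] [BorelSpace E] {Ω : Opens E}

theorem norm_dirichletInclusion_sub_ballMeanOperator_le (hΩ : volume (Ω : Set E) ≠ ⊤) {r : ℝ}
    (hr : 0 < r) (w : dirichletSpace Ω) :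
    ‖dirichletInclusion Ω w - ballMeanOperator hΩ r (dirichletInclusion Ω w)‖ ≤
      r * ‖dirichletGradient Ω w‖ := by
  induction w using denseRange_testFunctionToDirichletSpace.induction_on with
  | hp => exact isClosed_le (by fun_prop) (by fun_prop)
  | ih ψ =>
    have hfderiv : ‖dirichletGradient Ω (testFunctionToDirichletSpace ψ)‖ₑ =
        eLpNorm (fderiv ℝ ψ) 2 (volume.restrict (Ω : Set E)) := by
      rw [dirichletGradient_testFunction]
      refine (Lp.enorm_toLp (memLp_testFunction 2 _)).trans
        (eLpNorm_congr_enorm_ae (.of_forall fun x ↦ ?_))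
      rw [coe_gradientTestFunction]
      exact LinearIsometryEquiv.enorm_map _ _
    have h := enorm_toLp_sub_ballMeanOperator_le hΩ hr
      (ψ.contDiff.of_le (by exact_mod_cast le_top)) ψ.tsupport_subset (memLp_testFunction 2 ψ)
    rw [← hfderiv, ← ofReal_norm, ← ofReal_norm, ← ENNReal.ofReal_mul hr.le,
      ENNReal.ofReal_le_ofReal_iff (by positivity)] at h
    exact h

theorem isCompactOperator_dirichletInclusion (hΩ : volume (Ω : Set E) ≠ ⊤) :
    IsCompactOperator (dirichletInclusion Ω) := by
  refine isCompactOperator_of_tendsto (l := 𝓝[>] (0 : ℝ))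
    (F := fun r ↦ ballMeanOperator hΩ r ∘L dirichletInclusion Ω) ?_
    (.of_forall fun r ↦ (isCompactOperator_ballMeanOperator hΩ r).comp_clm _)
  refine tendsto_iff_norm_sub_tendsto_zero (E := dirichletSpace Ω →L[ℝ] L2On Ω ℝ).2 ?_
  refine squeeze_zero' (g := id) (.of_forall fun _ ↦ by positivity) ?_
    (tendsto_id.mono_left nhdsWithin_le_nhds)
  filter_upwards [self_mem_nhdsWithin] with r hr
  refine ContinuousLinearMap.opNorm_le_bound _ (le_of_lt hr) fun w ↦ ?_
  rw [sub_apply, ContinuousLinearMap.comp_apply, norm_sub_rev]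
  exact (norm_dirichletInclusion_sub_ballMeanOperator_le hΩ hr w).trans
    (mul_le_mul_of_nonneg_left (norm_dirichletGradient_le w) (le_of_lt hr))

theorem exists_norm_dirichletInclusion_le_mul_norm_dirichletGradient [Nontrivial E]
    (hΩ : volume (Ω : Set E) ≠ ⊤) :
    ∃ C, ∀ w, ‖dirichletInclusion Ω w‖ ≤ C * ‖dirichletGradient Ω w‖ := by
  have hlim : Tendsto (fun r ↦ √(volume.real (Ω : Set E) / volume.real (ball (0 : E) r)))
      atTop (𝓝 0) := by
    simpa using ((tendsto_measureReal_ball_atTop (E := E) volume 0).const_div_atTop _).sqrt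
  obtain ⟨r, hle, hr⟩ :=
    ((hlim.eventually_le_const one_half_pos).and (eventually_gt_atTop 0)).exists
  refine ⟨2 * r, fun w ↦ ?_⟩
  set u := dirichletInclusion Ω w
  have hsub : ‖u - ballMeanOperator hΩ r u‖ ≤ r * ‖dirichletGradient Ω w‖ :=
    norm_dirichletInclusion_sub_ballMeanOperator_le hΩ hr w
  have hmean : ‖ballMeanOperator hΩ r u‖ ≤ 1 / 2 * ‖u‖ :=
    (ballMeanOperator hΩ r).le_of_opNorm_le ((norm_ballMeanOperator_le hΩ r).trans hle) u
  linarith [norm_le_norm_sub_add u (ballMeanOperator hΩ r u)]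

end rellich

section constants

variable {E : Type*} [NormedAddCommGroup E] [InnerProductSpace ℝ E] [FiniteDimensional ℝ E]
  [MeasurableSpace E] [BorelSpace E] {Ω : Opens E}

theorem integral_dirichletInclusion_mul_fderiv (w : dirichletSpace Ω) (ψ : 𝓓(Ω, ℝ)) (v : E) :
    ∫ x in Ω, dirichletInclusion Ω w x * fderiv ℝ ψ x v =
      -∫ x in Ω, inner ℝ (dirichletGradient Ω w x) v * ψ x := by
  have hψ : MemLp (fun x ↦ fderiv ℝ ψ x v) 2 (volume.restrict (Ω : Set E)) :=
    Continuous.memLp_of_hasCompactSupport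
      ((ψ.contDiff.continuous_fderiv (by simp)).clm_apply continuous_const)
      (ψ.hasCompactSupport.fderiv_apply ℝ v)
  have hψv : MemLp (fun x ↦ ψ x • v) 2 (volume.restrict (Ω : Set E)) :=
    (ψ.continuous.smul continuous_const).memLp_of_hasCompactSupport ψ.hasCompactSupport.smul_right
  suffices inner ℝ (dirichletInclusion Ω w) (hψ.toLp _) =
      -inner ℝ (dirichletGradient Ω w) (hψv.toLp _) by
    rw [inner_toLp_eq_integral, inner_toLp_eq_integral] at this
    simpa only [RCLike.inner_apply, conj_trivial, real_inner_smul_right, mul_comm] using this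
  induction w using denseRange_testFunctionToDirichletSpace.induction_on with
  | hp => exact isClosed_eq (by fun_prop) (by fun_prop)
  | ih χ =>
    rw [real_inner_comm, real_inner_comm (hψv.toLp _), dirichletInclusion_testFunction,
      dirichletGradient_testFunction, inner_testFunctionToL2, inner_testFunctionToL2]
    calc ∫ x in Ω, inner ℝ (hψ.toLp _ x) (χ x)
        = ∫ x in Ω, χ x * fderiv ℝ ψ x v := by
          refine integral_congr_ae ?_
          filter_upwards [hψ.coeFn_toLp] with x hx
          rw [hx]
          rfl
      _ = -∫ x in Ω, fderiv ℝ χ x v * ψ x :=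
          setIntegral_mul_fderiv_testFunction_eq_neg (χ.contDiff.of_le (by simp)) ψ v
      _ = -∫ x in Ω, inner ℝ (hψv.toLp _ x) (gradientTestFunction Ω χ x) := by
          refine congrArg _ (integral_congr_ae ?_)
          filter_upwards [hψv.coeFn_toLp] with x hx
          rw [hx, coe_gradientTestFunction, real_inner_smul_left, inner_gradient_right]
          exact mul_comm _ _

theorem dirichletGradient_eq_zero_of_ae_eq_const {w : dirichletSpace Ω} {c : ℝ}
    (hw : dirichletInclusion Ω w =ᵐ[volume.restrict (Ω : Set E)] fun _ ↦ c) :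
    dirichletGradient Ω w = 0 := by
  rw [Lp.eq_zero_iff_ae_eq_zero]
  have hloc : LocallyIntegrable (dirichletGradient Ω w) (volume.restrict (Ω : Set E)) :=
    (Lp.memLp _).locallyIntegrable one_le_two
  refine ae_eq_zero_of_forall_setIntegral_testFunction_smul_eq_zero hloc
    fun ψ ↦ ext_inner_right ℝ fun v ↦ ?_
  have hint : Integrable (fun x ↦ ψ x • dirichletGradient Ω w x) (volume.restrict (Ω : Set E)) :=
    hloc.integrable_smul_left_of_hasCompactSupport ψ.continuous ψ.hasCompactSupport
  calc inner ℝ (∫ x in Ω, ψ x • dirichletGradient Ω w x) v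
      = ∫ x in Ω, inner ℝ (dirichletGradient Ω w x) v * ψ x := by
        rw [real_inner_comm, ← integral_inner hint]
        simp only [real_inner_smul_right, real_inner_comm, mul_comm]
    _ = -∫ x in Ω, c * fderiv ℝ ψ x v := by
        rw [eq_neg_iff_add_eq_zero, add_comm, ← eq_neg_iff_add_eq_zero,
          ← integral_dirichletInclusion_mul_fderiv]
        refine integral_congr_ae ?_
        filter_upwards [hw] with x hx
        rw [hx]
    _ = inner ℝ 0 v := by
        simp [setIntegral_mul_fderiv_testFunction_eq_neg (contDiff_const (c := c)) ψ v]

theorem dirichletInclusion_eq_zero_of_ae_eq_const [Nontrivial E] (hΩ : volume (Ω : Set E) ≠ ⊤)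
    {w : dirichletSpace Ω} {c : ℝ}
    (hw : dirichletInclusion Ω w =ᵐ[volume.restrict (Ω : Set E)] fun _ ↦ c) :
    dirichletInclusion Ω w = 0 := by
  obtain ⟨C, hC⟩ := exists_norm_dirichletInclusion_le_mul_norm_dirichletGradient hΩ
  simpa [dirichletGradient_eq_zero_of_ae_eq_const hw] using hC w

theorem notMem_range_dirichletInclusion_of_ae_eq_const [Nontrivial E]
    (hΩ : volume (Ω : Set E) ≠ ⊤) (hne : (Ω : Set E).Nonempty) {u : L2On Ω ℝ} {c : ℝ} (hc : c ≠ 0)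
    (hu : u =ᵐ[volume.restrict (Ω : Set E)] fun _ ↦ c) :
    u ∉ LinearMap.range (dirichletInclusion Ω).toLinearMap := by
  rintro ⟨w, rfl⟩
  have hzero : dirichletInclusion Ω w = 0 := dirichletInclusion_eq_zero_of_ae_eq_const hΩ hu
  have : (ae (volume.restrict (Ω : Set E))).NeBot :=
    ae_restrict_neBot.2 (Ω.isOpen.measure_pos volume hne).ne'
  obtain ⟨x, hx, hx0⟩ := (hu.and (Lp.eq_zero_iff_ae_eq_zero.1 hzero)).exists
  exact hc (hx.symm.trans hx0)

end constants

section resolvent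

variable {E : Type*} [NormedAddCommGroup E] [InnerProductSpace ℝ E] [FiniteDimensional ℝ E]
  [MeasurableSpace E] [BorelSpace E] {Ω : Opens E}

variable (Ω) in
/-- The operator `(1 - Δ)⁻¹` on `L²(Ω)` with Dirichlet boundary conditions. The adjoint is taken
with respect to the `H¹` inner product, so it sends `f` to the weak solution of `u - Δu = f`. -/
noncomputable def dirichletResolvent : L2On Ω ℝ →L[ℝ] L2On Ω ℝ :=
  dirichletInclusion Ω ∘L (dirichletInclusion Ω).adjoint

theorem isCompactOperator_dirichletResolvent (hΩ : volume (Ω : Set E) ≠ ⊤) :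
    IsCompactOperator (dirichletResolvent Ω) :=
  (isCompactOperator_dirichletInclusion hΩ).comp_clm _

theorem isSymmetric_dirichletResolvent : (dirichletResolvent Ω).IsSymmetric :=
  (ContinuousLinearMap.isPositive_self_comp_adjoint _).isSymmetric

theorem dirichletResolvent_apply_eq_iff {f u : L2On Ω ℝ} :
    dirichletResolvent Ω f = u ↔ ∃ w, dirichletInclusion Ω w = u ∧
      ∀ ψ : 𝓓(Ω, ℝ), inner ℝ w (testFunctionToDirichletSpace ψ) =
        inner ℝ f (testFunctionToL2 ψ) := by
  rw [dirichletResolvent, comp_adjoint_apply_eq_iff denseRange_testFunctionToDirichletSpace]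
  rfl

theorem injective_dirichletResolvent : Function.Injective (dirichletResolvent Ω) := by
  refine (ContinuousLinearMap.self_comp_adjoint_injective_iff (dirichletInclusion Ω)).2 ?_
  refine (injective_iff_map_eq_zero _).2 fun u hu ↦ ?_
  refine eq_zero_of_forall_inner_testFunctionToL2_eq_zero fun ψ ↦ ?_
  rw [← dirichletInclusion_testFunction, ← ContinuousLinearMap.adjoint_inner_left, hu,
    inner_zero_left]

end resolvent

section eigensequence

variable {d : ℕ} {Ω : Opens (EuclideanSpace ℝ (Fin d))}

theorem isDirichletEigenfunction_iff_dirichletResolvent_apply_eq {ev : ℝ} {u : L2On Ω ℝ} :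
    IsDirichletEigenfunction Ω ev u ↔ u ≠ 0 ∧ dirichletResolvent Ω ((1 + ev) • u) = u := by
  rw [IsDirichletEigenfunction, dirichletResolvent_apply_eq_iff]
  refine and_congr_right fun _ ↦ ?_
  simp only [hasDirichletGradient_iff]
  have hinner (w : dirichletSpace Ω) (ψ : 𝓓(Ω, ℝ)) :
      inner ℝ (dirichletInclusion Ω w) (testFunctionToL2 ψ) =
        ∫ x in Ω, dirichletInclusion Ω w x * ψ x :=
    (inner_testFunctionToL2 _ ψ).trans (integral_congr_ae (.of_forall fun x ↦ mul_comm _ _))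
  have hweak (w : dirichletSpace Ω) (ψ : 𝓓(Ω, ℝ)) :
      inner ℝ w (testFunctionToDirichletSpace ψ) =
          inner ℝ ((1 + ev) • dirichletInclusion Ω w) (testFunctionToL2 ψ) ↔
        ∫ x in Ω, inner ℝ (dirichletGradient Ω w x) (∇ ψ x) =
          ev * ∫ x in Ω, dirichletInclusion Ω w x * ψ x := by
    rw [inner_dirichletSpace, dirichletInclusion_testFunction, dirichletGradient_testFunction,
      real_inner_smul_left, add_mul, one_mul, add_right_inj, hinner,
      inner_testFunctionToL2, coe_gradientTestFunction]
  constructor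
  · rintro ⟨_, ⟨w, rfl, rfl⟩, h⟩
    exact ⟨w, rfl, fun ψ ↦ (hweak w ψ).2 (h ψ)⟩
  · rintro ⟨w, rfl, h⟩
    exact ⟨_, ⟨w, rfl, rfl⟩, fun ψ ↦ (hweak w ψ).1 (h ψ)⟩

theorem isDirichletEigenfunction_iff_mem_eigenspace {ev : ℝ} {u : L2On Ω ℝ} :
    IsDirichletEigenfunction Ω ev u ↔ u ≠ 0 ∧ 1 + ev ≠ 0 ∧
      u ∈ Module.End.eigenspace (dirichletResolvent Ω).toLinearMap (1 + ev)⁻¹ := by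
  rw [isDirichletEigenfunction_iff_dirichletResolvent_apply_eq, Module.End.mem_eigenspace_iff]
  refine and_congr_right fun hu ↦ ?_
  rcases eq_or_ne (1 + ev) 0 with hev | hev
  · simp [hev, hu.symm]
  · rw [map_smul, ← eq_inv_smul_iff₀ hev]
    simp [hev]

theorem IsDirichletEigenfunction.mem_range_dirichletInclusion {ev : ℝ} {u : L2On Ω ℝ}
    (hu : IsDirichletEigenfunction Ω ev u) :
    u ∈ LinearMap.range (dirichletInclusion Ω).toLinearMap := by
  obtain ⟨-, g, hg, -⟩ := hu
  obtain ⟨w, hw, -⟩ := hasDirichletGradient_iff.1 hg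
  exact ⟨w, hw⟩

theorem infinite_setOf_setIntegral_ne_zero (hd : 0 < d)
    (hne : (Ω : Set (EuclideanSpace ℝ (Fin d))).Nonempty)
    (hvol : volume (Ω : Set (EuclideanSpace ℝ (Fin d))) ≠ ⊤) {ι : Type*} {e : ι → L2On Ω ℝ}
    (he : Orthonormal ℝ e) (heig : ∀ i, ∃ ev, IsDirichletEigenfunction Ω ev (e i))
    (hspan : ∀ ev u, IsDirichletEigenfunction Ω ev u → u ∈ Submodule.span ℝ (Set.range e)) :
    {i | ∫ x in Ω, e i x ≠ 0}.Infinite := by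
  have : Nonempty (Fin d) := ⟨⟨0, hd⟩⟩
  have : IsFiniteMeasure (volume.restrict (Ω : Set (EuclideanSpace ℝ (Fin d)))) :=
    isFiniteMeasure_restrict.2 hvol
  have hcomplete : (Submodule.span ℝ (Set.range e))ᗮ = ⊥ := by
    refine orthogonal_eq_bot_of_eigenspace_le (isCompactOperator_dirichletResolvent hvol)
      isSymmetric_dirichletResolvent injective_dirichletResolvent fun μ hμ u hu ↦ ?_
    rcases eq_or_ne u 0 with rfl | hu0
    · exact Submodule.zero_mem _
    · exact hspan (μ⁻¹ - 1) u (isDirichletEigenfunction_iff_mem_eigenspace.2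
        ⟨hu0, by simpa using hμ, by simpa using hu⟩)
  have hone : MemLp (fun _ ↦ (1 : ℝ)) 2 (volume.restrict (Ω : Set (EuclideanSpace ℝ (Fin d)))) :=
    memLp_const 1
  have hinner (i : ι) : inner ℝ (e i) (hone.toLp _) = ∫ x in Ω, e i x := by
    rw [inner_toLp_eq_integral]
    simp
  simpa only [hinner] using infinite_setOf_inner_ne_zero he hcomplete
    (fun i ↦ (heig i).choose_spec.mem_range_dirichletInclusion)
    (notMem_range_dirichletInclusion_of_ae_eq_const hvol hne one_ne_zero hone.coeFn_toLp)

theorem exists_orthonormal_isDirichletEigenfunction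
    (hvol : volume (Ω : Set (EuclideanSpace ℝ (Fin d))) ≠ ⊤) :
    ∃ (ι : Type) (ev : ι → ℝ) (e : ι → L2On Ω ℝ), Orthonormal ℝ e ∧
      (∀ i, IsDirichletEigenfunction Ω (ev i) (e i)) ∧
      ∀ μ u, IsDirichletEigenfunction Ω μ u → u ∈ Submodule.span ℝ (e '' {i | ev i = μ}) := by
  obtain ⟨ι, e, he, hspan⟩ := exists_orthonormal_span_image_eq_eigenspace
    (isCompactOperator_dirichletResolvent hvol) isSymmetric_dirichletResolvent
  refine ⟨Σ μ, ι μ, fun i ↦ i.1.1⁻¹ - 1, e, he, fun i ↦ ?_, fun μ u hu ↦ ?_⟩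
  · refine isDirichletEigenfunction_iff_mem_eigenspace.2 ⟨he.ne_zero i, ?_, ?_⟩
    · simpa using i.1.2
    · rw [add_sub_cancel, inv_inv, ← hspan]
      exact Submodule.subset_span ⟨i, rfl, rfl⟩
  · obtain ⟨-, hμ, hmem⟩ := isDirichletEigenfunction_iff_mem_eigenspace.1 hu
    rw [← hspan ⟨(1 + μ)⁻¹, inv_ne_zero hμ⟩] at hmem
    refine Submodule.span_mono (Set.image_mono ?_) hmem
    rintro ⟨_, i⟩ rfl
    simp

theorem exists_isDirichletEigensequence (hd : 0 < d)
    (hne : (Ω : Set (EuclideanSpace ℝ (Fin d))).Nonempty)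
    (hvol : volume (Ω : Set (EuclideanSpace ℝ (Fin d))) ≠ ⊤) :
    ∃ (ev : ℕ → ℝ) (φ : ℕ → L2On Ω ℝ), IsDirichletEigensequence Ω ev φ := by
  obtain ⟨ι, ev, e, he, heig, hspan⟩ := exists_orthonormal_isDirichletEigenfunction hvol
  have : Infinite ι := Set.infinite_univ_iff.1 <|
    (infinite_setOf_setIntegral_ne_zero hd hne hvol he (fun i ↦ ⟨_, heig i⟩) fun μ u hu ↦
      Submodule.span_mono (Set.image_subset_range _ _) (hspan μ u hu)).mono (Set.subset_univ _)
  have : Fact ((2 : ENNReal) ≠ ⊤) := ⟨ENNReal.ofNat_ne_top⟩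
  have : Countable ι := countable_of_orthonormal he
  obtain ⟨f⟩ := nonempty_equiv_of_countable (α := ℕ) (β := ι)
  refine ⟨ev ∘ f, e ∘ f, he.comp f f.injective, fun k ↦ heig (f k), fun μ u hu ↦ ?_⟩
  refine Submodule.span_mono ?_ (hspan μ u hu)
  rintro _ ⟨i, hi, rfl⟩
  exact ⟨f.symm i, by simpa using hi, by simp⟩

end eigensequence

theorem mainTheorem2_general {d : ℕ} (hd : 0 < d) (Ω : Opens (EuclideanSpace ℝ (Fin d)))
    (hne : (Ω : Set (EuclideanSpace ℝ (Fin d))).Nonempty)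
    (hvol : volume (Ω : Set (EuclideanSpace ℝ (Fin d))) ≠ ⊤) :
    (∃ (ev : ℕ → ℝ) (φ : ℕ → L2On Ω ℝ), IsDirichletEigensequence Ω ev φ) ∧
    ∀ (ev : ℕ → ℝ) (φ : ℕ → L2On Ω ℝ),
      IsDirichletEigensequence Ω ev φ → {k : ℕ | ⨍ x in Ω, φ k x ≠ 0}.Infinite := by
  refine ⟨exists_isDirichletEigensequence hd hne hvol, fun ev φ h ↦ ?_⟩
  have hpos : volume.real (Ω : Set (EuclideanSpace ℝ (Fin d))) ≠ 0 :=
    ENNReal.toReal_ne_zero.2 ⟨(Ω.isOpen.measure_pos volume hne).ne', hvol⟩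
  simpa [setAverage_eq, hpos] using infinite_setOf_setIntegral_ne_zero hd hne hvol h.orthonormal
    (fun k ↦ ⟨_, h.eigenfunction k⟩) fun μ u hu ↦
      Submodule.span_mono (Set.image_subset_range _ _) (h.exhaustive μ u hu)

theorem mainTheorem2 {d : ℕ} (hd : 0 < d) (Ω : Opens (EuclideanSpace ℝ (Fin d)))
    (hconn : IsConnected (Ω : Set (EuclideanSpace ℝ (Fin d))))
    (hbdd : Bornology.IsBounded (Ω : Set (EuclideanSpace ℝ (Fin d)))) :
    (∃ (ev : ℕ → ℝ) (φ : ℕ → Lp ℝ 2 (volume.restrict (Ω : Set (EuclideanSpace ℝ (Fin d))))),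
      IsDirichletEigensequence Ω ev φ) ∧
    ∀ (ev : ℕ → ℝ) (φ : ℕ → Lp ℝ 2 (volume.restrict (Ω : Set (EuclideanSpace ℝ (Fin d))))),
      IsDirichletEigensequence Ω ev φ → {k : ℕ | ⨍ x in Ω, φ k x ≠ 0}.Infinite :=
  mainTheorem2_general hd Ω hconn.nonempty hbdd.measure_lt_top.ne
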